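/- Let $\kappa(0)=0$ and $\kappa(n)=[\log_2 n]+1+n/2^{[\log_2 n]}$ for integers $n\ge 1$, where $[\cdot]$ is the greatest integer function. For a norm $\|\cdot\|$ on $\mathbb R^n$ and $A\subset\mathbb R^n$ write $\operatorname{dist}(x,A)=\inf\{\|x-a\|:a\in A\}$. Let $n\ge 1$ and let $\|\cdot\|$ be any norm on $\mathbb R^n$. Then there is a real constant $C$, depending only on the norm, such that for every set $A\subset\mathbb R^n$ and every real $\delta$: if $$\operatorname{dist}\Big(\frac{a_0+a_1}{2},A\Big)\le\delta\quad\text{for all }a_0,a_1\in A,$$ then $$\operatorname{dist}(z,A)\le C\,\delta\quad\text{for all }z\in\operatorname{conv}(A).$$ There is a least such constant $C_{\|\cdot\|}$ (the sharp constant), and for every norm it satisfies $$\kappa(n-1)\le C_{\|\cdot\|}\le\kappa(n).$$ If $n\ge 2$ and $\|\cdot\|$ is the Euclidean norm, then $C_{\|\cdot\|}=\kappa(n-1)$. -/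

import Mathlib

/-- `κ(0) = 0` and `κ(n) = [log₂ n] + 1 + n / 2 ^ [log₂ n]` for `n ≥ 1`, where `[·]` is the
greatest integer function. -/
noncomputable def kappa (n : ℕ) : ℝ :=
  if n = 0 then 0
  else (⌊Real.logb 2 (n : ℝ)⌋ : ℝ) + 1 + (n : ℝ) / (2 : ℝ) ^ ⌊Real.logb 2 (n : ℝ)⌋

/-- The midpoint of any two points of `A` has distance at most `δ` from `A`.  (For empty `A`,
where `Metric.infDist` has a default value, the condition is vacuous.) -/
def MidpointsWithin {E : Type*} [NormedAddCommGroup E] [NormedSpace ℝ E]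
    (A : Set E) (δ : ℝ) : Prop :=
  ∀ a₀ ∈ A, ∀ a₁ ∈ A, Metric.infDist (midpoint ℝ a₀ a₁) A ≤ δ

/-- `C` is an admissible constant for the normed space `E`: for every set `A` and every `δ`, if
all midpoints of pairs of points of `A` are within `δ` of `A`, then all points of the convex hull
of `A` are within `C * δ` of `A`. -/
def IsHullConstant (E : Type*) [NormedAddCommGroup E] [NormedSpace ℝ E] (C : ℝ) : Prop :=
  ∀ (A : Set E) (δ : ℝ), MidpointsWithin A δ →
    ∀ z ∈ convexHull ℝ A, Metric.infDist z A ≤ C * δ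

/-- `C` is the sharp constant of `E`, i.e. the least admissible one. -/
def IsSharpHullConstant (E : Type*) [NormedAddCommGroup E] [NormedSpace ℝ E] (C : ℝ) : Prop :=
  IsLeast {c : ℝ | IsHullConstant E c} C

/-! `kappa m` is the sum over `k` of `min m (2 ^ k) / 2 ^ k`, and this series counts the nodes of a
binary tree.

Upper bound: the distance to `A` vanishes on `A` and is midpoint convex up to the error `δ`. By
Carathéodory, a point of the hull is a convex combination of at most `n + 1` points of `A`. Binary
expansion of the weights builds it from these points by iterated midpoints; for `m + 1` vertices,
depth `k` carries at most `min m (2 ^ k)` midpoints, each costing `δ / 2 ^ k`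
(`exists_multiset_sum_le`).

Lower bound: `∑ k, 2⁻ᵏ ∑ i, fract (2ᵏ αᵢ)` is midpoint convex up to `1` on the simplex and zero at
its vertices, and its truncations come arbitrarily close to `kappa (n - 1)` or exceed it. Take the
part above its graph over a very large simplex in a hyperplane: points of this set close to a base
point lie almost straight above it, hence high (`kappaPartial_le_of_isHullConstant`).

Euclidean case: maximise the distance `R` to the closure of `A` over the simplex. A maximum off the
interior of a full-dimensional simplex needs only `n` vertices, which gives `kappa (n - 1)`. An
interior maximum `z` lies in the closed hull of its nearest points. Their midpoints are at least `R
- δ` from `z`, so the directions from `z` to them have large inner products, and these cannot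
balance at `z` if `R > kappa (n - 1) * δ` (`mul_sq_le_of_isLocalMax`, `kappa_estimate`). -/

/-- The partial sums `∑_{k < K} min (m, 2 ^ k) / 2 ^ k` of the series with sum `kappa m`. -/
noncomputable def kappaPartial (m K : ℕ) : ℝ :=
  ∑ k ∈ Finset.range K, (min m (2 ^ k) : ℕ) / (2 : ℝ) ^ k

/-! ### The series for `kappa`. -/

theorem kappa_eq_log {m : ℕ} (hm : m ≠ 0) :
    kappa m = (Nat.log 2 m : ℝ) + 1 + (m : ℝ) / 2 ^ Nat.log 2 m := by
  have h : ⌊Real.logb 2 (m : ℝ)⌋ = (Nat.log 2 m : ℤ) := by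
    have := Real.floor_logb_natCast (b := 2) (r := (m : ℝ)) (Nat.cast_nonneg m)
    rw [Int.log_natCast] at this
    exact_mod_cast this
  rw [kappa, if_neg hm, h]
  simp

theorem kappaPartial_zero_left (K : ℕ) : kappaPartial 0 K = 0 := by
  simp [kappaPartial]

/-- The terms with `2 ^ k ≤ m` equal `1`; the later ones are `m / 2 ^ k`, a geometric tail. -/
theorem kappaPartial_log_add {m : ℕ} (hm : m ≠ 0) (j : ℕ) :
    kappaPartial m (Nat.log 2 m + 1 + j) =
      kappa m - (m : ℝ) / 2 ^ Nat.log 2 m * (1 / 2) ^ j := by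
  induction j with
  | zero =>
    have : ∀ k ∈ Finset.range (Nat.log 2 m + 1),
        ((min m (2 ^ k) : ℕ) : ℝ) / (2 : ℝ) ^ k = 1 := by
      intro k hk
      have : 2 ^ k ≤ m := (Nat.pow_le_pow_right (by norm_num)
        (Nat.lt_succ_iff.1 (Finset.mem_range.1 hk))).trans (Nat.pow_log_le_self 2 hm)
      rw [min_eq_right this]
      push_cast
      exact div_self (by positivity)
    rw [kappaPartial, add_zero, Finset.sum_congr rfl this, kappa_eq_log hm]
    simp
  | succ j ih =>
    have h2 : m < 2 ^ (Nat.log 2 m + 1 + j) :=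
      (Nat.lt_pow_succ_log_self (by norm_num) m).trans_le
        (Nat.pow_le_pow_right (by norm_num) (by omega))
    rw [kappaPartial, ← add_assoc, Finset.sum_range_succ, ← kappaPartial, ih, min_eq_left h2.le]
    have : (2 : ℝ) ^ Nat.log 2 m ≠ 0 := by positivity
    simp only [one_div, inv_pow, pow_add, pow_succ]
    field_simp
    ring

theorem kappaPartial_mono (m : ℕ) : Monotone (kappaPartial m) :=
  monotone_nat_of_le_succ fun K ↦ by
    rw [kappaPartial, kappaPartial, Finset.sum_range_succ]
    have : (0 : ℝ) ≤ (min m (2 ^ K) : ℕ) / (2 : ℝ) ^ K := by positivity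
    linarith

theorem kappaPartial_nonneg (m K : ℕ) : 0 ≤ kappaPartial m K :=
  Finset.sum_nonneg fun _ _ ↦ by positivity

theorem tendsto_kappaPartial (m : ℕ) :
    Filter.Tendsto (kappaPartial m) Filter.atTop (nhds (kappa m)) := by
  rcases eq_or_ne m 0 with rfl | hm
  · simp [funext kappaPartial_zero_left, kappa]
  · have h1 : Filter.Tendsto (fun j : ℕ ↦ kappa m - (m : ℝ) / 2 ^ Nat.log 2 m * (1 / 2) ^ j)
        Filter.atTop (nhds (kappa m - (m : ℝ) / 2 ^ Nat.log 2 m * 0)) :=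
      ((tendsto_pow_atTop_nhds_zero_of_lt_one (by norm_num) (by norm_num)).const_mul _).const_sub _
    rw [mul_zero, sub_zero] at h1
    rw [← Filter.tendsto_add_atTop_iff_nat (Nat.log 2 m + 1)]
    refine h1.congr fun j ↦ ?_
    rw [add_comm j, kappaPartial_log_add hm]

theorem kappaPartial_le_kappa (m K : ℕ) : kappaPartial m K ≤ kappa m :=
  (kappaPartial_mono m).ge_of_tendsto (tendsto_kappaPartial m) K

/-! ### Approximately convex functions and binary trees. -/

section Tree

variable {E : Type*} [AddCommGroup E] [Module ℝ E]

/-- Halving a multiset: points of a convex set can be paired up and replaced by midpoints. -/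
theorem exists_multiset_midpoints {T : Set E} (hT : Convex ℝ T) {f : E → ℝ} {δ : ℝ}
    (hf : ∀ x ∈ T, ∀ y ∈ T, f (midpoint ℝ x y) ≤ (f x + f y) / 2 + δ) (N : ℕ) :
    ∀ S : Multiset E, S.card = 2 * N → (∀ x ∈ S, x ∈ T) →
      ∃ S' : Multiset E, S'.card = N ∧ (∀ x ∈ S', x ∈ T) ∧ S'.sum = (1 / 2 : ℝ) • S.sum ∧
        (S'.map f).sum ≤ (S.map f).sum / 2 + N * δ := by
  induction N with
  | zero =>
    intro S hS _
    have : S = 0 := Multiset.card_eq_zero.1 (by simpa using hS)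
    exact ⟨0, by simp [this]⟩
  | succ N ih =>
    intro S hS hST
    obtain ⟨x, S₁, rfl⟩ := (Multiset.card_pos_iff_exists_mem.1 (by omega : 0 < S.card)).imp
      fun x hx ↦ Multiset.exists_cons_of_mem hx
    have hS1 : S₁.card = 2 * N + 1 := by
      rw [Multiset.card_cons] at hS
      omega
    obtain ⟨y, S₂, rfl⟩ := (Multiset.card_pos_iff_exists_mem.1 (by omega : 0 < S₁.card)).imp
      fun x hx ↦ Multiset.exists_cons_of_mem hx
    obtain ⟨S', hc, hm, hs, hb⟩ := ih S₂ (by rw [Multiset.card_cons] at hS1; omega)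
      fun w hw ↦ hST w (by simp [hw])
    have hx : x ∈ T := hST x (by simp)
    have hy : y ∈ T := hST y (by simp)
    refine ⟨midpoint ℝ x y ::ₘ S', by simp [hc], ?_, ?_, ?_⟩
    · intro w hw
      rcases Multiset.mem_cons.1 hw with rfl | hw
      · exact hT.midpoint_mem hx hy
      · exact hm w hw
    · simp only [Multiset.sum_cons, hs, midpoint_eq_smul_add, smul_add, add_assoc]
      norm_num
    · have := hf x hx y hy
      simp only [Multiset.map_cons, Multiset.sum_cons]
      push_cast
      linarith

variable {ι : Type*} [Fintype ι] [Nonempty ι]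

/-- The generating tree of Knuth and Yao: `∑ i, β i • a i` is a sum of `N = ∑ i, β i` points of
the hull of the `a i`, on which the values of an approximately convex function are controlled. -/
theorem exists_multiset_sum_le {T : Set E} (hT : Convex ℝ T) {f : E → ℝ} {δ M : ℝ}
    (hf : ∀ x ∈ T, ∀ y ∈ T, f (midpoint ℝ x y) ≤ (f x + f y) / 2 + δ) (hδ : 0 ≤ δ) (hM : 0 ≤ M)
    (hfM : ∀ x ∈ T, f x ≤ M) {a : ι → E} (haT : ∀ i, a i ∈ T) (ha : ∀ i, f (a i) ≤ 0) {m : ℕ}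
    (hι : Fintype.card ι ≤ m + 1) (K : ℕ) :
    ∀ (j : ℕ) (β : ι → ℝ) (N : ℕ), (∀ i, 0 ≤ β i) → ∑ i, β i = N → N ≤ m → N ≤ 2 ^ j →
      ∃ S : Multiset E, S.card = N ∧ (∀ x ∈ S, x ∈ T) ∧ S.sum = ∑ i, β i • a i ∧
        (S.map f).sum ≤
          δ * ∑ k ∈ Finset.range K, (min m (2 ^ (j + k)) : ℕ) / (2 : ℝ) ^ k +
            (1 / 2) ^ K * (m * M) := by
  induction K with
  | zero =>
    intro j β N hβ hN hNm _
    rcases Nat.eq_zero_or_pos N with rfl | hpos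
    · refine ⟨0, by simp, by simp, ?_, by simp; positivity⟩
      have h0 : ∀ i, β i = 0 := fun i ↦
        (Finset.sum_eq_zero_iff_of_nonneg fun i _ ↦ hβ i).1 (by simpa using hN) i
          (Finset.mem_univ i)
      simp [h0]
    -- At the cut-off depth, `N` copies of the normalised point are used, with only the crude bound
    -- `M`.
    · have hN0 : (0 : ℝ) < N := by exact_mod_cast hpos
      set x : E := ∑ i, (β i / N) • a i with hx
      have hxT : x ∈ T := hT.sum_mem (fun i _ ↦ div_nonneg (hβ i) hN0.le)
        (by rw [← Finset.sum_div, hN, div_self hN0.ne']) fun i _ ↦ haT i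
      refine ⟨Multiset.replicate N x, by simp, fun y hy ↦ ?_, ?_, ?_⟩
      · rwa [Multiset.eq_of_mem_replicate hy]
      · rw [Multiset.sum_replicate, hx, ← Nat.cast_smul_eq_nsmul ℝ, Finset.smul_sum]
        refine Finset.sum_congr rfl fun i _ ↦ ?_
        rw [smul_smul, mul_div_cancel₀ _ hN0.ne']
      · simp only [Multiset.map_replicate, Multiset.sum_replicate, nsmul_eq_mul,
          Finset.range_zero, Finset.sum_empty, mul_zero, zero_add, pow_zero, one_mul]
        have : (N : ℝ) ≤ m := by exact_mod_cast hNm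
        have h1 := mul_le_mul_of_nonneg_left (hfM x hxT) hN0.le
        have h2 := mul_le_mul_of_nonneg_right this hM
        linarith
  | succ K ih =>
    intro j β N hβ hN hNm hNj
    have hfl : ∀ i, ((⌊2 * β i⌋₊ : ℕ) : ℝ) = 2 * β i - Int.fract (2 * β i) := fun i ↦ by
      have := natCast_floor_eq_intCast_floor (show 0 ≤ 2 * β i by linarith [hβ i])
      rw [this, Int.self_sub_fract]
    -- After doubling, integer parts become leaves (copies of vertices, where `f ≤ 0`) and
    -- fractional parts pass to the next depth.
    set F : ℕ := ∑ i, ⌊2 * β i⌋₊ with hF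
    have hFsum : (F : ℝ) = 2 * N - ∑ i, Int.fract (2 * β i) := by
      rw [hF]
      push_cast
      simp only [hfl]
      rw [Finset.sum_sub_distrib, ← Finset.mul_sum, hN]
    have hfr0 : 0 ≤ ∑ i, Int.fract (2 * β i) := Finset.sum_nonneg fun i _ ↦ Int.fract_nonneg _
    -- The sum of the fractional parts is an integer below `m + 1`, hence at most `m`: the source of
    -- the cap `m`.
    have hfr1 : ∑ i, Int.fract (2 * β i) < m + 1 := by
      calc ∑ i, Int.fract (2 * β i) < ∑ _i : ι, (1 : ℝ) :=
            Finset.sum_lt_sum_of_nonempty Finset.univ_nonempty fun i _ ↦ Int.fract_lt_one _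
        _ ≤ m + 1 := by simpa using (by exact_mod_cast hι : (Fintype.card ι : ℝ) ≤ m + 1)
    have hF2 : F ≤ 2 * N := by
      have : (F : ℝ) ≤ 2 * N := by linarith
      exact_mod_cast this
    have hN' : ∑ i, Int.fract (2 * β i) = ((2 * N - F : ℕ) : ℝ) := by
      rw [Nat.cast_sub hF2]
      push_cast
      linarith
    obtain ⟨S, hc, hST, hs, hb⟩ := ih (j + 1) (fun i ↦ Int.fract (2 * β i)) (2 * N - F)
      (fun i ↦ Int.fract_nonneg _) hN'
      (by
        rw [hN'] at hfr1
        exact Nat.lt_succ_iff.1 (by exact_mod_cast hfr1))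
      (by rw [pow_succ]; omega)
    set V : Multiset E := ∑ i, ⌊2 * β i⌋₊ • ({a i} : Multiset E) with hV
    have hVmem : ∀ x ∈ V, ∃ i, x = a i := by
      intro x hx
      obtain ⟨i, -, hi⟩ := Multiset.mem_sum.1 hx
      exact ⟨i, by simpa using Multiset.mem_of_mem_nsmul hi⟩
    have hVf : (V.map f).sum ≤ 0 := by
      refine (Multiset.sum_le_card_nsmul _ 0 fun y hy ↦ ?_).trans (smul_zero _).le
      obtain ⟨x, hx, rfl⟩ := Multiset.mem_map.1 hy
      obtain ⟨i, rfl⟩ := hVmem x hx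
      exact ha i
    have hVcard : V.card = F := by simp [hV, hF]
    have hVsum : V.sum = ∑ i, (2 * β i - Int.fract (2 * β i)) • a i := by
      rw [hV, Multiset.sum_sum]
      refine Finset.sum_congr rfl fun i _ ↦ ?_
      rw [Multiset.sum_nsmul, Multiset.sum_singleton, ← hfl, Nat.cast_smul_eq_nsmul]
    obtain ⟨S', hc', hT', hs', hb'⟩ := exists_multiset_midpoints hT hf N (S + V)
      (by rw [Multiset.card_add, hc, hVcard]; omega) (fun x hx ↦ by
        rcases Multiset.mem_add.1 hx with h | h
        · exact hST x h
        · obtain ⟨i, rfl⟩ := hVmem x h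
          exact haT i)
    refine ⟨S', hc', hT', ?_, ?_⟩
    · rw [hs', Multiset.sum_add, hs, hVsum, ← Finset.sum_add_distrib, Finset.smul_sum]
      refine Finset.sum_congr rfl fun i _ ↦ ?_
      rw [← add_smul, smul_smul]
      congr 1
      ring
    · rw [Multiset.map_add, Multiset.sum_add] at hb'
      have hNmin : (N : ℝ) ≤ (min m (2 ^ j) : ℕ) := by
        exact_mod_cast le_min hNm hNj
      have hsplit : ∑ k ∈ Finset.range (K + 1), ((min m (2 ^ (j + k)) : ℕ) : ℝ) / (2 : ℝ) ^ k =
          (∑ k ∈ Finset.range K, ((min m (2 ^ (j + 1 + k)) : ℕ) : ℝ) / (2 : ℝ) ^ k) / 2 +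
            (min m (2 ^ j) : ℕ) := by
        rw [Finset.sum_range_succ', Finset.sum_div]
        simp only [pow_zero, div_one, add_zero]
        congr 1
        refine Finset.sum_congr rfl fun k _ ↦ ?_
        rw [pow_succ, div_div, show j + (k + 1) = j + 1 + k by ring]
      rw [hsplit, pow_succ]
      have := mul_le_mul_of_nonneg_right hNmin hδ
      nlinarith

/-- An approximately convex function that is bounded on a simplex with at most `m + 1` vertices
and nonpositive at the vertices is at most `kappa m * δ`. -/
theorem approxConvex_le_kappa {T : Set E} (hT : Convex ℝ T) {f : E → ℝ} {δ M : ℝ}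
    (hf : ∀ x ∈ T, ∀ y ∈ T, f (midpoint ℝ x y) ≤ (f x + f y) / 2 + δ) (hδ : 0 ≤ δ) (hM : 0 ≤ M)
    (hfM : ∀ x ∈ T, f x ≤ M) {a : ι → E} (haT : ∀ i, a i ∈ T) (ha : ∀ i, f (a i) ≤ 0) {m : ℕ}
    (hι : Fintype.card ι ≤ m + 1) {w : ι → ℝ} (hw : ∀ i, 0 ≤ w i) (hw1 : ∑ i, w i = 1) :
    f (∑ i, w i • a i) ≤ kappa m * δ := by
  rcases Nat.eq_zero_or_pos m with rfl | hm
  -- The tree starts with `N = 1 ≤ m`, so a single vertex is treated apart.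
  · have : Subsingleton ι := Fintype.card_le_one_iff_subsingleton.1 hι
    obtain ⟨i⟩ := ‹Nonempty ι›
    have hu : (Finset.univ : Finset ι) = {i} := by
      ext x
      simp [Subsingleton.elim x i]
    rw [hu, Finset.sum_singleton] at hw1 ⊢
    simpa [hw1, kappa] using ha i
  · have key : ∀ K : ℕ, f (∑ i, w i • a i) ≤ kappa m * δ + (1 / 2) ^ K * (m * M) := by
      intro K
      obtain ⟨S, hc, -, hs, hb⟩ := exists_multiset_sum_le hT hf hδ hM hfM haT ha hι K 0 w 1 hw
        (by simpa using hw1) hm (by simp)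
      obtain ⟨x, rfl⟩ := Multiset.card_eq_one.1 hc
      simp only [Multiset.sum_singleton, Multiset.map_singleton, zero_add] at hs hb
      rw [← kappaPartial] at hb
      rw [← hs]
      have := mul_le_mul_of_nonneg_right (kappaPartial_le_kappa m K) hδ
      linarith
    have ht : Filter.Tendsto (fun K : ℕ ↦ kappa m * δ + (1 / 2 : ℝ) ^ K * (m * M)) Filter.atTop
        (nhds (kappa m * δ + 0 * (m * M))) :=
      ((tendsto_pow_atTop_nhds_zero_of_lt_one (by norm_num) (by norm_num)).mul_const _).const_add _
    rw [zero_mul, add_zero] at ht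
    exact ge_of_tendsto' ht key

end Tree

/-! ### The upper bound for every norm. -/

section UpperBound

variable {E : Type*} [NormedAddCommGroup E] [NormedSpace ℝ E]

theorem MidpointsWithin.nonneg {A : Set E} {δ : ℝ} (h : MidpointsWithin A δ) (hA : A.Nonempty) :
    0 ≤ δ :=
  hA.elim fun a ha ↦ Metric.infDist_nonneg.trans (h a ha a ha)

theorem norm_midpoint_sub_midpoint_le (x y p q : E) :
    ‖midpoint ℝ x y - midpoint ℝ p q‖ ≤ (‖x - p‖ + ‖y - q‖) / 2 := by
  have : midpoint ℝ x y - midpoint ℝ p q = (2⁻¹ : ℝ) • ((x - p) + (y - q)) := by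
    rw [midpoint_eq_smul_add, midpoint_eq_smul_add, ← smul_sub, invOf_eq_inv]
    congr 1
    abel
  rw [this, norm_smul]
  have := norm_add_le (x - p) (y - q)
  norm_num
  linarith

/-- The distance to an approximately convex set is an approximately convex function. -/
theorem MidpointsWithin.infDist_midpoint_le {A : Set E} {δ : ℝ} (h : MidpointsWithin A δ)
    (hA : A.Nonempty) (x y : E) :
    Metric.infDist (midpoint ℝ x y) A ≤ (Metric.infDist x A + Metric.infDist y A) / 2 + δ := by
  refine le_of_forall_pos_le_add fun ε hε ↦ ?_
  obtain ⟨p, hp, hxp⟩ := (Metric.infDist_lt_iff hA).1 (lt_add_of_pos_right (Metric.infDist x A) hε)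
  obtain ⟨q, hq, hyq⟩ := (Metric.infDist_lt_iff hA).1 (lt_add_of_pos_right (Metric.infDist y A) hε)
  have h1 := norm_midpoint_sub_midpoint_le x y p q
  have h2 := Metric.infDist_le_infDist_add_dist (s := A) (x := midpoint ℝ x y)
    (y := midpoint ℝ p q)
  have h3 := h p hp q hq
  rw [dist_eq_norm] at hxp hyq h2
  linarith

/-- Allows the Euclidean part to work with closed sets, where nearest points exist. -/
theorem MidpointsWithin.closure {A : Set E} {δ : ℝ} (h : MidpointsWithin A δ) :
    MidpointsWithin (closure A) δ := by
  rcases A.eq_empty_or_nonempty with rfl | hA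
  · simpa using h
  · intro x hx y hy
    have := h.infDist_midpoint_le hA x y
    rw [Metric.infDist_closure]
    rwa [(Metric.mem_closure_iff_infDist_zero hA).1 hx,
      (Metric.mem_closure_iff_infDist_zero hA).1 hy, add_zero, zero_div, zero_add] at this

/-- Points of the convex hull of `m + 1` points of `A` are within `kappa m * δ` of `A`. -/
theorem MidpointsWithin.infDist_sum_le {A : Set E} {δ : ℝ} (h : MidpointsWithin A δ)
    {ι : Type*} [Fintype ι] [Nonempty ι] {a : ι → E} (ha : ∀ i, a i ∈ A) {m : ℕ}
    (hι : Fintype.card ι ≤ m + 1) {w : ι → ℝ} (hw : ∀ i, 0 ≤ w i) (hw1 : ∑ i, w i = 1) :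
    Metric.infDist (∑ i, w i • a i) A ≤ kappa m * δ := by
  have hA : A.Nonempty := ⟨_, ha (Classical.arbitrary ι)⟩
  obtain ⟨M, hM⟩ := ((Set.finite_range a).isCompact_convexHull ℝ).bddAbove_image
    (Metric.continuous_infDist_pt A).continuousOn
  have haT : ∀ i, a i ∈ convexHull ℝ (Set.range a) := fun i ↦
    subset_convexHull ℝ _ (Set.mem_range_self i)
  have hbd : ∀ x ∈ convexHull ℝ (Set.range a), Metric.infDist x A ≤ M := fun x hx ↦
    hM ⟨x, hx, rfl⟩
  exact approxConvex_le_kappa (convex_convexHull ℝ (Set.range a))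
    (f := fun x ↦ Metric.infDist x A) (fun x _ y _ ↦ h.infDist_midpoint_le hA x y)
    (h.nonneg hA) (Metric.infDist_nonneg.trans (hbd _ (haT (Classical.arbitrary ι)))) hbd haT
    (fun i ↦ (Metric.infDist_zero_of_mem (ha i)).le) hι hw hw1

/-- Carathéodory; the affine independence provides barycentric coordinates in the Euclidean case. -/
theorem exists_affineIndependent_of_mem_convexHull [FiniteDimensional ℝ E] {A : Set E} {z : E}
    (hz : z ∈ convexHull ℝ A) :
    ∃ (t : Finset E) (w : t → ℝ), (t : Set E) ⊆ A ∧ AffineIndependent ℝ ((↑) : t → E) ∧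
      t.card ≤ Module.finrank ℝ E + 1 ∧ Nonempty t ∧
      (∀ i, 0 ≤ w i) ∧ ∑ i, w i = 1 ∧ ∑ i, w i • (i : E) = z := by
  rw [convexHull_eq_union] at hz
  simp only [Set.mem_iUnion] at hz
  obtain ⟨t, htA, hti, hzt⟩ := hz
  have hne : t.Nonempty := by
    have : (t : Set E).Nonempty := convexHull_nonempty_iff.1 ⟨z, hzt⟩
    simpa using this
  obtain ⟨w, hw0, hw1, hwz⟩ := Finset.mem_convexHull'.1 hzt
  refine ⟨t, fun i ↦ w i, htA, hti, ?_, hne.to_subtype, fun i ↦ hw0 _ i.2, ?_, ?_⟩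
  · have := hti.card_le_finrank_succ
    rw [Fintype.card_coe] at this
    exact this.trans (Nat.succ_le_succ (Submodule.finrank_le _))
  · rw [← hw1, ← Finset.sum_coe_sort t w]
  · rw [← hwz, ← Finset.sum_coe_sort t fun y ↦ w y • y]

theorem isHullConstant_kappa_finrank [FiniteDimensional ℝ E] :
    IsHullConstant E (kappa (Module.finrank ℝ E)) := by
  intro A δ h z hz
  obtain ⟨t, w, htA, -, hcard, hne, hw0, hw1, rfl⟩ := exists_affineIndependent_of_mem_convexHull hz
  exact h.infDist_sum_le (fun i ↦ htA i.2) (by simpa using hcard) hw0 hw1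

/-- An admissible constant and a lower bound for all of them give the sharp constant. -/
theorem exists_isSharpHullConstant {a b : ℝ} (hb : IsHullConstant E b)
    (ha : ∀ c, IsHullConstant E c → a ≤ c) :
    ∃ C, IsSharpHullConstant E C ∧ a ≤ C ∧ C ≤ b := by
  have hbdd : BddBelow {c : ℝ | IsHullConstant E c} := ⟨a, ha⟩
  have hne : {c : ℝ | IsHullConstant E c}.Nonempty := ⟨b, hb⟩
  -- Each condition on `c` is a closed linear inequality, so the infimum is attained.
  have hcl : IsClosed {c : ℝ | IsHullConstant E c} := by
    simp only [IsHullConstant, Set.ofPred_forall]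
    refine isClosed_iInter fun A ↦ isClosed_iInter fun δ ↦ isClosed_iInter fun _ ↦
      isClosed_iInter fun z ↦ isClosed_iInter fun _ ↦ ?_
    exact isClosed_le continuous_const (continuous_id.mul continuous_const)
  exact ⟨_, ⟨hcl.csInf_mem hne hbdd, fun c hc ↦ csInf_le hbdd hc⟩, le_csInf hne ha,
    csInf_le hbdd hb⟩

end UpperBound

/-! ### The lower bound for every norm. -/

section LowerBound

/-- Truncations of the extremal approximately convex function on the simplex. -/
noncomputable def truncatedExtremal {ι : Type*} [Fintype ι] (K : ℕ) (α : ι → ℝ) : ℝ :=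
  ∑ k ∈ Finset.range K, (∑ i, Int.fract (2 ^ k * α i)) / 2 ^ k

theorem truncatedExtremal_mono {ι : Type*} [Fintype ι] (α : ι → ℝ) :
    Monotone fun K ↦ truncatedExtremal K α :=
  monotone_nat_of_le_succ fun K ↦ by
    simp only [truncatedExtremal]
    rw [Finset.sum_range_succ]
    have : 0 ≤ (∑ i, Int.fract (2 ^ K * α i)) / 2 ^ K :=
      div_nonneg (Finset.sum_nonneg fun i _ ↦ Int.fract_nonneg _) (by positivity)
    linarith

theorem truncatedExtremal_nonneg {ι : Type*} [Fintype ι] (K : ℕ) (α : ι → ℝ) :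
    0 ≤ truncatedExtremal K α :=
  Finset.sum_nonneg fun _ _ ↦
    div_nonneg (Finset.sum_nonneg fun i _ ↦ Int.fract_nonneg _) (by positivity)

theorem truncatedExtremal_single {ι : Type*} [Fintype ι] [DecidableEq ι] (K : ℕ) (i : ι) :
    truncatedExtremal K (Pi.single i (1 : ℝ)) = 0 := by
  refine Finset.sum_eq_zero fun k _ ↦ ?_
  rw [Finset.sum_eq_zero, zero_div]
  intro j _
  rcases eq_or_ne j i with rfl | hj
  · have : (2 : ℝ) ^ k = ((2 ^ k : ℤ) : ℝ) := by push_cast; rfl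
    rw [Pi.single_eq_same, mul_one, this, Int.fract_intCast]
  · simp [hj]

/-- Halving shifts the index `k` by one, and `Int.fract` is subadditive. The new term `k = 0` is at
most the coordinate sum `1`, which is the error. -/
theorem truncatedExtremal_midpoint_le {ι : Type*} [Fintype ι] (K : ℕ) {α β : ι → ℝ}
    (hα : α ∈ stdSimplex ℝ ι) (hβ : β ∈ stdSimplex ℝ ι) :
    truncatedExtremal K (midpoint ℝ α β) ≤
      (truncatedExtremal K α + truncatedExtremal K β) / 2 + 1 := by
  have hm : ∀ i, midpoint ℝ α β i = (α i + β i) / 2 := fun i ↦ by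
    simp [midpoint_eq_smul_add]
    ring
  have key : ∀ K, truncatedExtremal (K + 1) (midpoint ℝ α β) ≤
      (truncatedExtremal K α + truncatedExtremal K β) / 2 + 1 := by
    intro K
    simp only [truncatedExtremal]
    rw [Finset.sum_range_succ', ← Finset.sum_add_distrib,
      Finset.sum_div (Finset.range K)]
    refine add_le_add (Finset.sum_le_sum fun k _ ↦ ?_) ?_
    · rw [← add_div, ← Finset.sum_add_distrib, div_div, ← pow_succ]
      refine div_le_div_of_nonneg_right (Finset.sum_le_sum fun i _ ↦ ?_) (by positivity)
      rw [hm, show (2 : ℝ) ^ (k + 1) * ((α i + β i) / 2) = 2 ^ k * α i + 2 ^ k * β i by ring]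
      exact Int.fract_add_le _ _
    · simp only [pow_zero, one_mul, div_one]
      calc ∑ i, Int.fract (midpoint ℝ α β i) ≤ ∑ i, (α i + β i) / 2 :=
            Finset.sum_le_sum fun i _ ↦ by
              rw [← hm]
              exact sub_le_self _ (by
                have : 0 ≤ midpoint ℝ α β i := by
                  rw [hm]
                  linarith [hα.1 i, hβ.1 i]
                exact_mod_cast Int.floor_nonneg.2 this)
        _ = 1 := by
              rw [← Finset.sum_div, Finset.sum_add_distrib, hα.2, hβ.2]
              norm_num
  exact (truncatedExtremal_mono _ K.le_succ).trans (key K)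

/-- Supplies numerators of dyadic weights `c i / 2 ^ (r + 1)` with sum `1`. -/
theorem exists_one_le_le_two_sum_eq {m s : ℕ} (h1 : m ≤ s) (h2 : s ≤ 2 * m) :
    ∃ c : Fin m → ℕ, (∀ i, 1 ≤ c i) ∧ (∀ i, c i ≤ 2) ∧ ∑ i, c i = s := by
  induction m generalizing s with
  | zero => exact ⟨fun _ ↦ 1, by simp, by simp, by simp; omega⟩
  | succ m ih =>
    obtain ⟨e, he1, he2, h3, h4⟩ : ∃ e, 1 ≤ e ∧ e ≤ 2 ∧ m + e ≤ s ∧ s ≤ 2 * m + e := by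
      by_cases h : m + 2 ≤ s
      · exact ⟨2, by omega⟩
      · exact ⟨1, by omega⟩
    obtain ⟨c, hc1, hc2, hc⟩ := ih (s := s - e) (by omega) (by omega)
    refine ⟨Fin.cons e c, Fin.cases he1 hc1, Fin.cases he2 hc2, ?_⟩
    rw [Fin.sum_cons, hc]
    omega

theorem le_sum_fract_of_lt {ι : Type*} [Fintype ι] {m : ℕ} {x : ι → ℝ} {N : ℤ}
    (hx : ∑ i, x i = N) (h : (m : ℝ) - 1 < ∑ i, Int.fract (x i)) :
    (m : ℝ) ≤ ∑ i, Int.fract (x i) := by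
  have : ∑ i, Int.fract (x i) = ((N - ∑ i, ⌊x i⌋ : ℤ) : ℝ) := by
    push_cast
    rw [← hx, ← Finset.sum_sub_distrib]
    rfl
  rw [this] at h ⊢
  have h' : (m : ℤ) - 1 < N - ∑ i, ⌊x i⌋ := by exact_mod_cast h
  have : (m : ℤ) ≤ N - ∑ i, ⌊x i⌋ := by omega
  exact_mod_cast this

/-- Near a suitable point of the simplex with `m + 1` vertices the truncated extremal function
is at least `kappaPartial m K`. -/
theorem exists_forall_kappaPartial_le_truncatedExtremal (m K : ℕ) :
    ∃ α₀ ∈ stdSimplex ℝ (Fin (m + 1)), ∃ ε > 0, ∀ α ∈ stdSimplex ℝ (Fin (m + 1)),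
      (∀ i : Fin m, |α i.castSucc - α₀ i.castSucc| < ε) →
        kappaPartial m K ≤ truncatedExtremal K α := by
  rcases Nat.eq_zero_or_pos m with rfl | hm
  · exact ⟨_, single_mem_stdSimplex ℝ 0, 1, one_pos, fun α _ _ ↦ by
      rw [kappaPartial_zero_left]
      exact truncatedExtremal_nonneg K α⟩
  set r := Nat.log 2 m with hr
  have hmr : 2 ^ r ≤ m := Nat.pow_log_le_self 2 hm.ne'
  have hmr' : m < 2 ^ (r + 1) := Nat.lt_pow_succ_log_self (by norm_num) m
  obtain ⟨c, hc1, hc2, hc⟩ := exists_one_le_le_two_sum_eq (m := m) (s := 2 ^ (r + 1)) hmr'.le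
    (by rw [pow_succ]; omega)
  have hm0 : (0 : ℝ) < m := by exact_mod_cast hm
  -- The first `m` coordinates are kept within `η` below dyadic numbers; `η` is so small that
  -- multiplying by `2 ^ k` with `k < K` leaves a gap of at most `1 / m`.
  set η : ℝ := 1 / (m * 2 ^ (K + r + 1)) with hη
  have hη0 : 0 < η := by positivity
  have hmη : m * η = 1 / 2 ^ (K + r + 1) := by
    rw [hη]
    field_simp
  have hcsum : ∑ i, (c i : ℝ) / 2 ^ (r + 1) = 1 := by
    rw [← Finset.sum_div, div_eq_one_iff_eq (by positivity)]
    exact_mod_cast hc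
  have hηc : ∀ i, η ≤ (c i : ℝ) / 2 ^ (r + 1) := by
    intro i
    have h1 : (1 : ℝ) ≤ c i := by exact_mod_cast hc1 i
    have h2 : (1 : ℝ) ≤ m := by exact_mod_cast hm
    rw [hη]
    refine div_le_div₀ (by positivity) h1 (by positivity) ?_
    calc (2 : ℝ) ^ (r + 1) ≤ 2 ^ (K + r + 1) := pow_le_pow_right₀ (by norm_num) (by omega)
      _ ≤ m * 2 ^ (K + r + 1) := le_mul_of_one_le_left (by positivity) h2
  -- The centre of these windows; the last coordinate collects the deficit.
  refine ⟨Fin.snoc (fun i ↦ (c i : ℝ) / 2 ^ (r + 1) - η / 2) (m * (η / 2)), ⟨?_, ?_⟩, η / 2,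
    by positivity, fun α hα hnear ↦ ?_⟩
  · refine Fin.lastCases ?_ fun i ↦ ?_
    · rw [Fin.snoc_last]
      positivity
    · rw [Fin.snoc_castSucc]
      linarith [hηc i]
  · rw [Fin.sum_snoc, Finset.sum_sub_distrib, hcsum]
    simp
  · simp only [Fin.snoc_castSucc, abs_lt] at hnear
    have hlo : ∀ i : Fin m, (c i : ℝ) / 2 ^ (r + 1) - η < α i.castSucc := fun i ↦ by
      linarith [(hnear i).1]
    have hhi : ∀ i : Fin m, α i.castSucc < (c i : ℝ) / 2 ^ (r + 1) := fun i ↦ by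
      linarith [(hnear i).2]
    have hsum := hα.2
    rw [Fin.sum_univ_castSucc] at hsum
    have hlast : α (Fin.last m) ≤ m * η := by
      have : ∑ i, ((c i : ℝ) / 2 ^ (r + 1) - η) ≤ ∑ i : Fin m, α i.castSucc :=
        Finset.sum_le_sum fun i _ ↦ (hlo i).le
      rw [Finset.sum_sub_distrib, hcsum] at this
      simp only [Finset.sum_const, Finset.card_univ, Fintype.card_fin, nsmul_eq_mul] at this
      linarith
    refine Finset.sum_le_sum fun k hk ↦ div_le_div_of_nonneg_right ?_ (by positivity)
    have hkK := Finset.mem_range.1 hk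
    have hsumk : ∑ i, 2 ^ k * α i = ((2 ^ k : ℤ) : ℝ) := by
      rw [← Finset.mul_sum, hα.2, mul_one]
      push_cast
      rfl
    -- For `k ≤ r` all `2 ^ k * α i` are below `1`, so the fractional parts sum to `2 ^ k`. For `k >
    -- r`, `m` of them exceed `1 - 1 / m`, and integrality lifts their sum to `m`.
    by_cases hkr : k ≤ r
    · refine (Nat.cast_le.2 (min_le_right m (2 ^ k))).trans ?_
      have hlt : ∀ i, 2 ^ k * α i < 1 := by
        have hpow : (2 : ℝ) ^ k ≤ 2 ^ r := pow_le_pow_right₀ (by norm_num) hkr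
        refine Fin.lastCases ?_ fun i ↦ ?_
        · calc 2 ^ k * α (Fin.last m) ≤ 2 ^ r * (1 / 2 ^ (K + r + 1)) := by
                rw [← hmη]
                exact mul_le_mul hpow hlast (hα.1 _) (by positivity)
            _ < 1 := by
                rw [mul_one_div, div_lt_one (by positivity)]
                exact pow_lt_pow_right₀ (by norm_num) (by omega)
        · have h2 : (c i : ℝ) ≤ 2 := by exact_mod_cast hc2 i
          calc 2 ^ k * α i.castSucc ≤ 2 ^ r * α i.castSucc :=
                mul_le_mul_of_nonneg_right hpow (hα.1 _)
            _ < 2 ^ r * ((c i : ℝ) / 2 ^ (r + 1)) :=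
                mul_lt_mul_of_pos_left (hhi i) (by positivity)
            _ = c i / 2 := by
                rw [pow_succ]
                field_simp
            _ ≤ 1 := by linarith
      have : ∀ i, Int.fract (2 ^ k * α i) = 2 ^ k * α i := fun i ↦
        Int.fract_eq_self.2 ⟨mul_nonneg (by positivity) (hα.1 i), hlt i⟩
      simp only [this, hsumk]
      push_cast
      exact le_rfl
    · refine (Nat.cast_le.2 (min_le_left m (2 ^ k))).trans (le_sum_fract_of_lt hsumk ?_)
      obtain ⟨d, rfl⟩ : ∃ d, k = r + 1 + d := ⟨k - (r + 1), by omega⟩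
      have hfr : ∀ i : Fin m, 1 - 1 / (m : ℝ) < Int.fract (2 ^ (r + 1 + d) * α i.castSucc) := by
        intro i
        have hint : (2 : ℝ) ^ (r + 1 + d) * ((c i : ℝ) / 2 ^ (r + 1)) =
            ((2 ^ d * c i : ℤ) : ℝ) := by
          rw [pow_add]
          push_cast
          field_simp
        have h1 : (2 : ℝ) ^ (r + 1 + d) * α i.castSucc < ((2 ^ d * c i : ℤ) : ℝ) := by
          rw [← hint]
          exact mul_lt_mul_of_pos_left (hhi i) (by positivity)
        have h2 : ((2 ^ d * c i : ℤ) : ℝ) - 1 / m < (2 : ℝ) ^ (r + 1 + d) * α i.castSucc := by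
          have h3 := mul_lt_mul_of_pos_left (hlo i) (show (0 : ℝ) < 2 ^ (r + 1 + d) by positivity)
          rw [mul_sub, hint] at h3
          have h4 : (2 : ℝ) ^ (r + 1 + d) * η ≤ 1 / m := by
            rw [hη, mul_one_div, div_le_div_iff₀ (by positivity) hm0, one_mul, mul_comm]
            exact mul_le_mul_of_nonneg_left (pow_le_pow_right₀ (by norm_num) (by omega)) hm0.le
          linarith
        have h5 : ⌊(2 : ℝ) ^ (r + 1 + d) * α i.castSucc⌋ ≤ 2 ^ d * c i - 1 :=
          Int.le_sub_one_of_lt (Int.floor_lt.2 h1)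
        have h6 : ((⌊(2 : ℝ) ^ (r + 1 + d) * α i.castSucc⌋ : ℤ) : ℝ) ≤
            ((2 ^ d * c i : ℤ) : ℝ) - 1 := by exact_mod_cast h5
        rw [Int.fract]
        linarith
      rw [Fin.sum_univ_castSucc]
      have : Nonempty (Fin m) := ⟨⟨0, hm⟩⟩
      have h7 : ∑ _i : Fin m, (1 - 1 / (m : ℝ)) <
          ∑ i : Fin m, Int.fract (2 ^ (r + 1 + d) * α i.castSucc) :=
        Finset.sum_lt_sum_of_nonempty Finset.univ_nonempty fun i _ ↦ hfr i
      have h8 : ∑ _i : Fin m, (1 - 1 / (m : ℝ)) = m - 1 := by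
        simp only [Finset.sum_const, Finset.card_univ, Fintype.card_fin, nsmul_eq_mul]
        field_simp
      have h9 := Int.fract_nonneg ((2 : ℝ) ^ (r + 1 + d) * α (Fin.last m))
      linarith

variable {E : Type*} [NormedAddCommGroup E] [NormedSpace ℝ E]

/-- The set above the graph of a function on the simplex, in the direction `u`, over the simplex
with vertices `v i`. -/
def simplexEpigraph {ι : Type*} [Fintype ι] (v : ι → E) (u : E) (F : (ι → ℝ) → ℝ) : Set E :=
  {x | ∃ α ∈ stdSimplex ℝ ι, ∃ t, F α ≤ t ∧ x = ∑ i, α i • v i + t • u}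

/-- Raising the midpoint by the unit vector `u` absorbs the convexity error `1`. -/
theorem midpointsWithin_simplexEpigraph {ι : Type*} [Fintype ι] (v : ι → E) {u : E} (hu : ‖u‖ = 1)
    {F : (ι → ℝ) → ℝ} (hF : ∀ α ∈ stdSimplex ℝ ι, ∀ β ∈ stdSimplex ℝ ι,
      F (midpoint ℝ α β) ≤ (F α + F β) / 2 + 1) :
    MidpointsWithin (simplexEpigraph v u F) 1 := by
  rintro _ ⟨α, hα, s, hs, rfl⟩ _ ⟨β, hβ, t, ht, rfl⟩
  set p := ∑ i, midpoint ℝ α β i • v i + ((s + t) / 2 + 1) • u with hp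
  have hpA : p ∈ simplexEpigraph v u F :=
    ⟨_, (convex_stdSimplex ℝ ι).midpoint_mem hα hβ, _, by linarith [hF α hα β hβ], rfl⟩
  refine (Metric.infDist_le_dist_of_mem hpA).trans ?_
  have : p - midpoint ℝ (∑ i, α i • v i + s • u) (∑ i, β i • v i + t • u) = u := by
    have h1 : ∑ i, midpoint ℝ α β i • v i =
        (2⁻¹ : ℝ) • (∑ i, α i • v i) + (2⁻¹ : ℝ) • ∑ i, β i • v i := by
      rw [Finset.smul_sum, Finset.smul_sum, ← Finset.sum_add_distrib]
      refine Finset.sum_congr rfl fun i _ ↦ ?_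
      simp only [midpoint_eq_smul_add, Pi.smul_apply, Pi.add_apply, invOf_eq_inv, smul_eq_mul]
      module
    rw [hp, h1, midpoint_eq_smul_add, invOf_eq_inv]
    module
  rw [dist_comm, dist_eq_norm, this, hu]

theorem sum_smul_mem_convexHull_simplexEpigraph {ι : Type*} [Fintype ι] [DecidableEq ι]
    (v : ι → E) (u : E) {F : (ι → ℝ) → ℝ} (hF : ∀ i, F (Pi.single i 1) ≤ 0) {α : ι → ℝ}
    (hα : α ∈ stdSimplex ℝ ι) :
    ∑ i, α i • v i ∈ convexHull ℝ (simplexEpigraph v u F) := by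
  refine (convex_convexHull ℝ _).sum_mem (fun i _ ↦ hα.1 i) hα.2 fun i _ ↦
    subset_convexHull ℝ _ ⟨Pi.single i 1, single_mem_stdSimplex ℝ i, 0, hF i, ?_⟩
  simp [Pi.single_apply, ite_smul]

theorem exists_antilipschitz_family_ker [FiniteDimensional ℝ E] {m : ℕ}
    (hE : Module.finrank ℝ E = m + 1) {φ : StrongDual ℝ E} (hφ : φ ≠ 0) :
    ∃ (b : Fin m → E) (c : ℝ), 0 ≤ c ∧ (∀ i, φ (b i) = 0) ∧
      ∀ (β : Fin m → ℝ) (i : Fin m), |β i| ≤ c * ‖∑ j, β j • b j‖ := by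
  have hrank : Module.finrank ℝ (LinearMap.ker (φ : E →ₗ[ℝ] ℝ)) = m := by
    have h1 := LinearMap.finrank_range_add_finrank_ker (φ : E →ₗ[ℝ] ℝ)
    have h2 : LinearMap.range (φ : E →ₗ[ℝ] ℝ) = ⊤ := LinearMap.range_eq_top.2
      (LinearMap.surjective fun h ↦ hφ (by ext x; exact LinearMap.congr_fun h x))
    rw [h2, finrank_top, Module.finrank_self, hE] at h1
    omega
  obtain ⟨b, hli, hφb⟩ : ∃ b : Fin m → E, LinearIndependent ℝ b ∧ ∀ i, φ (b i) = 0 := by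
    obtain ⟨B⟩ : Nonempty (Module.Basis (Fin m) ℝ (LinearMap.ker (φ : E →ₗ[ℝ] ℝ))) :=
      ⟨Module.finBasisOfFinrankEq ℝ _ hrank⟩
    exact ⟨_, B.linearIndependent.map' (Submodule.subtype _) (Submodule.ker_subtype _),
      fun i ↦ (B i).2⟩
  obtain ⟨c, -, hc⟩ := LinearMap.exists_antilipschitzWith (Fintype.linearCombination ℝ b)
    (LinearMap.ker_eq_bot.2 hli.fintypeLinearCombination_injective)
  refine ⟨b, c, c.2, hφb, fun β i ↦ ?_⟩
  have h1 := hc.le_mul_dist β 0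
  rw [map_zero, dist_zero_right, dist_zero_right, Fintype.linearCombination_apply] at h1
  exact (norm_le_pi_norm β i).trans h1

theorem kappaPartial_le_of_isHullConstant [FiniteDimensional ℝ E] {m : ℕ}
    (hE : Module.finrank ℝ E = m + 1) (K : ℕ) {C : ℝ} (hC : IsHullConstant E C) :
    kappaPartial m K ≤ C := by
  have : Nontrivial E := Module.nontrivial_of_finrank_pos (R := ℝ) (by omega)
  obtain ⟨u, hu⟩ := exists_norm_eq E zero_le_one
  -- `φ` is the height along `u`; having norm `1`, it never exceeds the distance.
  obtain ⟨φ, hφ, hφu⟩ := exists_dual_vector ℝ u (by rw [hu]; exact one_ne_zero)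
  rw [hu] at hφu
  have hφu : φ u = 1 := by simpa using hφu
  obtain ⟨b, c, hc0, hφb, hb⟩ := exists_antilipschitz_family_ker hE
    (φ := φ) (by rintro rfl; simp at hφ)
  obtain ⟨α₀, hα₀, ε, hε, hnear⟩ := exists_forall_kappaPartial_le_truncatedExtremal m K
  set S := kappaPartial m K with hS
  have hS0 : 0 ≤ S := kappaPartial_nonneg m K
  -- Stretching by `L` makes a base displacement of at most `2 * S` change each of the first `m`
  -- coordinates by less than `ε`.
  set L : ℝ := c * (2 * S) / ε + 1 with hL
  have hL0 : 0 < L := by positivity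
  have hLε : c * (2 * S) < L * ε := by
    rw [hL, add_mul, div_mul_cancel₀ _ hε.ne']
    linarith
  set v : Fin (m + 1) → E := Fin.snoc (fun i ↦ L • b i) 0 with hv
  have hvsum : ∀ α : Fin (m + 1) → ℝ,
      ∑ i, α i • v i = ∑ i : Fin m, (L * α i.castSucc) • b i := fun α ↦ by
    rw [Fin.sum_univ_castSucc]
    simp only [hv, Fin.snoc_castSucc, Fin.snoc_last, smul_zero, add_zero, smul_smul]
    exact Finset.sum_congr rfl fun i _ ↦ by rw [mul_comm]
  have hz := sum_smul_mem_convexHull_simplexEpigraph v u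
    (F := truncatedExtremal K) (fun i ↦ (truncatedExtremal_single K i).le) hα₀
  have h1 := hC _ 1 (midpointsWithin_simplexEpigraph v hu
    fun α hα β hβ ↦ truncatedExtremal_midpoint_le K hα hβ) _ hz
  rw [mul_one] at h1
  refine le_trans ((Metric.le_infDist (convexHull_nonempty_iff.1 ⟨_, hz⟩)).2 ?_) h1
  rintro _ ⟨α, hα, t, ht, rfl⟩
  by_contra! hlt
  rw [dist_eq_norm, hvsum, hvsum] at hlt
  set D := ∑ i : Fin m, (L * α₀ i.castSucc) • b i -
    (∑ i : Fin m, (L * α i.castSucc) • b i + t • u) with hD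
  have hφD : φ D = -t := by simp [hD, hφb, hφu]
  have htD : |t| ≤ ‖D‖ := by
    have := φ.le_opNorm D
    rwa [hφ, one_mul, hφD, norm_neg, Real.norm_eq_abs] at this
  have hW : ‖∑ i : Fin m, (L * (α₀ i.castSucc - α i.castSucc)) • b i‖ ≤ 2 * S := by
    have h2 : ∑ i : Fin m, (L * (α₀ i.castSucc - α i.castSucc)) • b i = D + t • u := by
      simp only [hD, mul_sub, sub_smul, Finset.sum_sub_distrib]
      abel
    rw [h2]
    refine (norm_add_le _ _).trans ?_
    rw [norm_smul, hu, mul_one, Real.norm_eq_abs]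
    linarith
  have hnear' := hnear α hα fun i ↦ by
    have h3 := (hb _ i).trans (mul_le_mul_of_nonneg_left hW hc0)
    rw [abs_mul, abs_of_pos hL0, abs_sub_comm] at h3
    exact lt_of_mul_lt_mul_left (h3.trans_lt hLε) hL0.le
  linarith [le_abs_self t]

theorem kappa_le_of_isHullConstant [FiniteDimensional ℝ E] {m : ℕ}
    (hE : Module.finrank ℝ E = m + 1) {C : ℝ} (hC : IsHullConstant E C) : kappa m ≤ C :=
  le_of_tendsto' (tendsto_kappaPartial m) fun K ↦ kappaPartial_le_of_isHullConstant hE K hC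

end LowerBound

/-! ### The sharp constant in Euclidean space. -/

section Euclidean

variable {E : Type*} [NormedAddCommGroup E] [InnerProductSpace ℝ E]

/-- The distance to `A` is 1-Lipschitz, so the midpoint is at least `R - δ` from `z`; expanding the
square of `(p - z) + (q - z)` gives the bound. -/
theorem le_inner_of_infDist_midpoint_le {A : Set E} {δ R : ℝ} {z p q : E} (hδ : δ ≤ R)
    (hz : Metric.infDist z A = R) (hp : ‖p - z‖ = R) (hq : ‖q - z‖ = R)
    (h : Metric.infDist (midpoint ℝ p q) A ≤ δ) :
    2 * (R - δ) ^ 2 - R ^ 2 ≤ inner ℝ (p - z) (q - z) := by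
  have h1 := Metric.infDist_le_infDist_add_dist (s := A) (x := z) (y := midpoint ℝ p q)
  have h2 : 2 * dist z (midpoint ℝ p q) = ‖(p - z) + (q - z)‖ := by
    rw [dist_comm, dist_eq_norm]
    have : (p - z) + (q - z) = (2 : ℝ) • (midpoint ℝ p q - z) := by
      rw [midpoint_eq_smul_add, invOf_eq_inv]
      module
    rw [this, norm_smul]
    norm_num
  have h3 := norm_add_sq_real (p - z) (q - z)
  rw [← h2, hp, hq] at h3
  have h4 : R - δ ≤ dist z (midpoint ℝ p q) := by linarith
  have h5 := pow_le_pow_left₀ (by linarith) h4 2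
  nlinarith

/-- A convex combination of few vectors of length `R` with pairwise inner products at least `s`
cannot be short. -/
theorem le_norm_sq_of_le_inner {ι : Type*} [Fintype ι] {n : ℕ} (hι : Fintype.card ι ≤ n + 1)
    {x : ι → E} {R s : ℝ} (hx : ∀ i, ‖x i‖ = R) (hs : ∀ i j, s ≤ inner ℝ (x i) (x j))
    {w : ι → ℝ} (hw : ∀ i, 0 ≤ w i) (hw1 : ∑ i, w i = 1) (hsR : s ≤ R ^ 2) :
    s + (R ^ 2 - s) / (n + 1) ≤ ‖∑ i, w i • x i‖ ^ 2 := by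
  classical
  have h1 : ‖∑ i, w i • x i‖ ^ 2 = ∑ i, ∑ j, w i * w j * inner ℝ (x i) (x j) := by
    rw [← real_inner_self_eq_norm_sq, sum_inner]
    refine Finset.sum_congr rfl fun i _ ↦ ?_
    rw [inner_sum]
    refine Finset.sum_congr rfl fun j _ ↦ ?_
    rw [real_inner_smul_left, real_inner_smul_right]
    ring
  have h2 : ∑ i, ∑ j, w i * w j * (s + if i = j then R ^ 2 - s else 0) ≤
      ∑ i, ∑ j, w i * w j * inner ℝ (x i) (x j) := by
    refine Finset.sum_le_sum fun i _ ↦ Finset.sum_le_sum fun j _ ↦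
      mul_le_mul_of_nonneg_left ?_ (mul_nonneg (hw i) (hw j))
    split_ifs with hij
    · subst hij
      rw [real_inner_self_eq_norm_sq, hx]
      linarith
    · linarith [hs i j]
  have h3 : ∑ i, ∑ j, w i * w j * (s + if i = j then R ^ 2 - s else 0) =
      s + (R ^ 2 - s) * ∑ i, w i ^ 2 := by
    simp only [mul_add, Finset.sum_add_distrib, mul_ite, mul_zero, Finset.sum_ite_eq,
      Finset.mem_univ, if_true, ← Finset.sum_mul, ← Finset.mul_sum, hw1]
    simp only [← sq]
    ring
  -- Cauchy–Schwarz: spreading the weights evenly minimises the diagonal contribution.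
  have h4 : 1 ≤ (n + 1 : ℝ) * ∑ i, w i ^ 2 := by
    have h5 := sq_sum_le_card_mul_sum_sq (s := Finset.univ) (f := w)
    rw [hw1, Finset.card_univ] at h5
    have h6 : (Fintype.card ι : ℝ) ≤ n + 1 := by exact_mod_cast hι
    have h7 : 0 ≤ ∑ i, w i ^ 2 := Finset.sum_nonneg fun i _ ↦ sq_nonneg _
    nlinarith
  rw [h1]
  refine le_trans ?_ (h3 ▸ h2)
  have : (R ^ 2 - s) / (n + 1) ≤ (R ^ 2 - s) * ∑ i, w i ^ 2 := by
    rw [div_le_iff₀ (by positivity), mul_assoc]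
    have := mul_le_mul_of_nonneg_left h4 (sub_nonneg.2 hsR)
    linarith
  linarith

variable [FiniteDimensional ℝ E]

/-- At a local maximum of the distance to a closed set, every closed half space
bounded by a hyperplane through the maximum contains a nearest point. -/
theorem exists_nearest_inner_nonneg {A : Set E} (hA : IsClosed A) (hne : A.Nonempty) {z : E}
    (hmax : ∀ᶠ y in nhds z, Metric.infDist y A ≤ Metric.infDist z A) (v : E) :
    ∃ p ∈ A, ‖p - z‖ = Metric.infDist z A ∧ 0 ≤ inner ℝ v (p - z) := by
  by_contra! hcon
  set R := Metric.infDist z A with hR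
  have hdist : ∀ p ∈ A, R ≤ ‖p - z‖ := fun p hp ↦ by
    rw [← dist_eq_norm, dist_comm]
    exact Metric.infDist_le_dist_of_mem hp
  -- Closedness gives a uniform gap, so after a small move along `v` the nearest point lies in the
  -- open half space behind `z`, and the distance has grown.
  obtain ⟨η, hη, hfar⟩ : ∃ η > 0, ∀ p ∈ A, 0 ≤ inner ℝ v (p - z) → R + η ≤ ‖p - z‖ := by
    set H : Set E := A ∩ {p | 0 ≤ inner ℝ v (p - z)} with hH
    rcases H.eq_empty_or_nonempty with hemp | hHne
    · refine ⟨1, one_pos, fun p hp hpv ↦ ?_⟩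
      have : p ∈ H := ⟨hp, hpv⟩
      simp [hemp] at this
    · have hHcl : IsClosed H := hA.inter (isClosed_le (by fun_prop) (by fun_prop))
      obtain ⟨p, hp, hpd⟩ := hHcl.exists_infDist_eq_dist hHne z
      rw [dist_comm, dist_eq_norm] at hpd
      have hlt : R < ‖p - z‖ := (hdist p hp.1).lt_of_ne fun h ↦
        (hcon p hp.1 h.symm).not_ge hp.2
      refine ⟨‖p - z‖ - R, sub_pos.2 hlt, fun q hq hqv ↦ ?_⟩
      have := Metric.infDist_le_dist_of_mem (x := z) (show q ∈ H from ⟨hq, hqv⟩)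
      rw [dist_comm, dist_eq_norm, hpd] at this
      linarith
  have hc : Filter.Tendsto (fun t : ℝ ↦ z + t • v) (nhdsWithin 0 (Set.Ioi 0)) (nhds z) := by
    have : Continuous fun t : ℝ ↦ z + t • v := by fun_prop
    simpa using (this.tendsto 0).mono_left nhdsWithin_le_nhds
  have hn : ∀ᶠ t : ℝ in nhdsWithin 0 (Set.Ioi 0), ‖t • v‖ < η := by
    have : Continuous fun t : ℝ ↦ ‖t • v‖ := by fun_prop
    have h0 := (this.tendsto 0).mono_left (nhdsWithin_le_nhds (s := Set.Ioi 0))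
    rw [zero_smul, norm_zero] at h0
    exact h0.eventually (gt_mem_nhds hη)
  have hpos : ∀ᶠ t : ℝ in nhdsWithin 0 (Set.Ioi 0), t ∈ Set.Ioi 0 := self_mem_nhdsWithin
  obtain ⟨t, ht0, htmax, htn⟩ :=
    (hpos.and ((hc.eventually hmax).and hn)).exists
  rw [Set.mem_Ioi] at ht0
  obtain ⟨q, hq, hqd⟩ := hA.exists_infDist_eq_dist hne (z + t • v)
  have hq1 : ‖q - z - t • v‖ ≤ R := by
    rwa [hqd, dist_comm, dist_eq_norm, ← sub_sub] at htmax
  have hq2 : ‖q - z‖ < R + η := by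
    have := norm_add_le (q - z - t • v) (t • v)
    rw [sub_add_cancel] at this
    linarith
  have hq3 : inner ℝ v (q - z) < 0 := by
    by_contra! h
    exact (hfar q hq h).not_gt hq2
  have h1 := norm_sub_sq_real (q - z) (t • v)
  rw [real_inner_smul_right, real_inner_comm] at h1
  have h2 := pow_le_pow_left₀ Metric.infDist_nonneg (hdist q hq) 2
  have h3 := pow_le_pow_left₀ (norm_nonneg _) hq1 2
  have h4 := mul_neg_of_pos_of_neg ht0 hq3
  have h5 := sq_nonneg ‖t • v‖
  linarith

/-- Otherwise a separating hyperplane, translated to `z`, bounds a closed half space free of nearest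
points. -/
theorem mem_closure_convexHull_nearest {A : Set E} (hA : IsClosed A) (hne : A.Nonempty) {z : E}
    (hmax : ∀ᶠ y in nhds z, Metric.infDist y A ≤ Metric.infDist z A) :
    z ∈ closure (convexHull ℝ {p | p ∈ A ∧ ‖p - z‖ = Metric.infDist z A}) := by
  by_contra hz
  obtain ⟨f, u, hf, hu⟩ := geometric_hahn_banach_closed_point
    (convex_convexHull ℝ {p | p ∈ A ∧ ‖p - z‖ = Metric.infDist z A}).closure isClosed_closure hz
  obtain ⟨p, hpA, hpR, hp⟩ := exists_nearest_inner_nonneg hA hne hmax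
    ((InnerProductSpace.toDual ℝ E).symm f)
  rw [InnerProductSpace.toDual_symm_apply, map_sub] at hp
  have := hf p (subset_closure (subset_convexHull ℝ _ ⟨hpA, hpR⟩))
  linarith

/-- The lower bound for the squared distance to `z` passes to the closed hull of the nearest points,
and is evaluated at `z` itself, where that distance is zero. -/
theorem mul_sq_le_of_isLocalMax {A : Set E} {δ : ℝ} (h : MidpointsWithin A δ) (hA : IsClosed A)
    (hne : A.Nonempty) {z : E} (hδ : δ ≤ Metric.infDist z A)
    (hmax : ∀ᶠ y in nhds z, Metric.infDist y A ≤ Metric.infDist z A) :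
    2 * Module.finrank ℝ E * (Metric.infDist z A - δ) ^ 2 ≤
      (Module.finrank ℝ E - 1) * Metric.infDist z A ^ 2 := by
  set R := Metric.infDist z A with hR
  set n := Module.finrank ℝ E with hn
  have hδ0 := h.nonneg hne
  set s := 2 * (R - δ) ^ 2 - R ^ 2 with hs
  have hsR : s ≤ R ^ 2 := by nlinarith
  have hsub : closure (convexHull ℝ {p | p ∈ A ∧ ‖p - z‖ = R}) ⊆
      {y | s + (R ^ 2 - s) / (n + 1) ≤ ‖y - z‖ ^ 2} := by
    refine closure_minimal (fun y hy ↦ ?_) (isClosed_le (by fun_prop) (by fun_prop))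
    obtain ⟨t, w, htP, -, hcard, -, hw0, hw1, rfl⟩ := exists_affineIndependent_of_mem_convexHull hy
    have hy' : ∑ i, w i • (i : E) - z = ∑ i : t, w i • ((i : E) - z) := by
      simp only [smul_sub, Finset.sum_sub_distrib]
      rw [← Finset.sum_smul, hw1, one_smul]
    rw [Set.mem_ofPred_eq, hy']
    exact le_norm_sq_of_le_inner (by simpa using hcard) (fun i ↦ (htP i.2).2)
      (fun i j ↦ le_inner_of_infDist_midpoint_le hδ hR.symm (htP i.2).2 (htP j.2).2
        (h _ (htP i.2).1 _ (htP j.2).1)) hw0 hw1 hsR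
  have hz := hsub (mem_closure_convexHull_nearest hA hne hmax)
  rw [Set.mem_ofPred_eq, sub_self, norm_zero] at hz
  have hn1 : (0 : ℝ) < n + 1 := by positivity
  have h1 : s * (n + 1) + (R ^ 2 - s) ≤ 0 := by
    have h2 := mul_le_mul_of_nonneg_right hz hn1.le
    rw [add_mul, div_mul_cancel₀ _ hn1.ne'] at h2
    linarith
  rw [hs] at h1
  linarith

/-- Makes `mul_sq_le_of_isLocalMax` fail once `R > kappa (n - 1) * δ`. Equality holds for `n = 2`;
from `7 / 2 > 2 + √2` on, `κ² ≤ 2 (κ - 1)²` suffices. -/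
theorem kappa_estimate {n : ℕ} (hn : 2 ≤ n) :
    1 ≤ kappa (n - 1) ∧
      (n - 1 : ℝ) * kappa (n - 1) ^ 2 ≤ 2 * n * (kappa (n - 1) - 1) ^ 2 := by
  obtain ⟨m, rfl⟩ : ∃ m, n = m + 1 := ⟨n - 1, by omega⟩
  rw [Nat.add_sub_cancel]
  push_cast
  have hm0 : (0 : ℝ) ≤ m := by positivity
  rw [add_sub_cancel_right]
  suffices H : (m = 1 ∧ kappa m = 2) ∨ (m = 2 ∧ kappa m = 3) ∨ 7 / 2 ≤ kappa m by
    rcases H with ⟨rfl, h⟩ | ⟨rfl, h⟩ | h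
    · rw [h]; norm_num
    · rw [h]; norm_num
    · refine ⟨by linarith, ?_⟩
      have h1 : kappa m ^ 2 ≤ 2 * (kappa m - 1) ^ 2 := by nlinarith
      have h2 := mul_le_mul_of_nonneg_left h1 hm0
      nlinarith [sq_nonneg (kappa m - 1)]
  have hk := kappa_eq_log (m := m) (by omega)
  have hl1 : Nat.log 2 1 = 0 := by simp
  have hl2 : Nat.log 2 2 = 1 := Nat.log_eq_of_pow_le_of_lt_pow (by norm_num) (by norm_num)
  have hl3 : Nat.log 2 3 = 1 := Nat.log_eq_of_pow_le_of_lt_pow (by norm_num) (by norm_num)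
  obtain rfl | rfl | rfl | h4 : m = 1 ∨ m = 2 ∨ m = 3 ∨ 4 ≤ m := by omega
  · left
    rw [hk, hl1]
    norm_num
  · right; left
    rw [hk, hl2]
    norm_num
  · right; right
    rw [hk, hl3]
    norm_num
  · right; right
    have h5 : 2 ≤ Nat.log 2 m := Nat.le_log_of_pow_le (by norm_num) (by omega)
    have h6 : (2 : ℝ) ≤ Nat.log 2 m := by exact_mod_cast h5
    have h7 : (1 : ℝ) ≤ m / 2 ^ Nat.log 2 m := by
      rw [le_div_iff₀ (by positivity), one_mul]
      exact_mod_cast Nat.pow_log_le_self 2 (by omega : m ≠ 0)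
    linarith

theorem infDist_le_of_isLocalMax {A : Set E} {δ : ℝ} (h : MidpointsWithin A δ) (hA : IsClosed A)
    (hne : A.Nonempty) (hn : 2 ≤ Module.finrank ℝ E) {z : E}
    (hmax : ∀ᶠ y in nhds z, Metric.infDist y A ≤ Metric.infDist z A) :
    Metric.infDist z A ≤ kappa (Module.finrank ℝ E - 1) * δ := by
  by_contra! hlt
  obtain ⟨hk1, hk2⟩ := kappa_estimate hn
  have hδ0 := h.nonneg hne
  set κ := kappa (Module.finrank ℝ E - 1) with hκ
  set n := Module.finrank ℝ E with hn'
  set R := Metric.infDist z A with hR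
  have hn2 : (2 : ℝ) ≤ n := by exact_mod_cast hn
  have hδR : δ ≤ R := by nlinarith
  have h1 := mul_sq_le_of_isLocalMax h hA hne hδR hmax
  have hR0 : 0 < R := lt_of_le_of_lt (by positivity) hlt
  have h2 : (κ - 1) * R < κ * (R - δ) := by linarith
  have h3 : ((κ - 1) * R) ^ 2 < (κ * (R - δ)) ^ 2 :=
    pow_lt_pow_left₀ h2 (mul_nonneg (by linarith) hR0.le) two_ne_zero
  have h4 := mul_le_mul_of_nonneg_left h1 (sq_nonneg κ)
  have h5 := mul_le_mul_of_nonneg_left hk2 (sq_nonneg R)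
  have h6 := mul_lt_mul_of_pos_left h3 (show (0 : ℝ) < 2 * n by linarith)
  nlinarith

theorem isHullConstant_kappa_finrank_sub_one (hn : 2 ≤ Module.finrank ℝ E) :
    IsHullConstant E (kappa (Module.finrank ℝ E - 1)) := by
  intro A δ hδA z hz
  have hAne : A.Nonempty := convexHull_nonempty_iff.1 ⟨z, hz⟩
  rw [← Metric.infDist_closure]
  have h := hδA.closure
  have hcl : IsClosed (closure A) := isClosed_closure
  have hne : (closure A).Nonempty := hAne.closure
  obtain ⟨t, w, htA, hti, hcard, htne, hw0, hw1, rfl⟩ :=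
    exists_affineIndependent_of_mem_convexHull (convexHull_mono subset_closure hz)
  generalize closure A = B at *
  set g : (t → ℝ) → E := fun w ↦ ∑ i, w i • (i : E) with hg
  have hgc : Continuous g := by fun_prop
  obtain ⟨w', hw', hmax⟩ := (isCompact_stdSimplex ℝ t).exists_isMaxOn ⟨w, hw0, hw1⟩
    ((Metric.continuous_infDist_pt B).comp hgc).continuousOn
  refine (hmax (show w ∈ stdSimplex ℝ t from ⟨hw0, hw1⟩)).trans ?_
  change Metric.infDist (g w') B ≤ _
  -- With all weights positive on a full simplex, nearby points keep positive barycentric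
  -- coordinates, so the maximum is local in `E`. Otherwise at most `finrank` vertices carry the
  -- point.
  by_cases hdeg : t.card = Module.finrank ℝ E + 1 ∧ ∀ i, 0 < w' i
  · refine infDist_le_of_isLocalMax h hcl hne hn ?_
    have htop : affineSpan ℝ (Set.range ((↑) : t → E)) = ⊤ :=
      hti.affineSpan_eq_top_iff_card_eq_finrank_add_one.2 (by simpa using hdeg.1)
    let b : AffineBasis t ℝ E := ⟨(↑), hti, htop⟩
    have hb : ∀ x : E, g (fun i ↦ b.coord i x) = x := fun x ↦
      b.linear_combination_coord_eq_self x
    have hcoord : (fun i ↦ b.coord i (g w')) = w' := by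
      funext i
      have h1 : Finset.univ.affineCombination ℝ b w' = g w' :=
        Finset.univ.affineCombination_eq_linear_combination b w' hw'.2
      rw [← h1]
      exact b.coord_apply_combination_of_mem (Finset.mem_univ i) hw'.2
    have hev : ∀ᶠ y in nhds (g w'), ∀ i, 0 < b.coord i y := by
      rw [Filter.eventually_all]
      intro i
      refine (continuous_barycentric_coord b i).continuousAt.eventually (lt_mem_nhds ?_)
      rw [congrFun hcoord i]
      exact hdeg.2 i
    filter_upwards [hev] with y hy
    have := hmax (show (fun i ↦ b.coord i y) ∈ stdSimplex ℝ t from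
      ⟨fun i ↦ (hy i).le, b.sum_coord_apply_eq_one y⟩)
    simpa [hb] using this
  · rw [not_and_or] at hdeg
    rcases hdeg with hlt | hex
    · exact h.infDist_sum_le (fun i ↦ htA i.2) (by rw [Fintype.card_coe]; omega) hw'.1 hw'.2
    · push Not at hex
      obtain ⟨i₀, hi₀⟩ := hex
      have h0 : w' i₀ = 0 := le_antisymm hi₀ (hw'.1 i₀)
      classical
      have hsum : ∑ i : {i // i ≠ i₀}, w' i = 1 := by
        have := Fintype.sum_eq_add_sum_subtype_ne w' i₀
        rw [h0, zero_add, hw'.2] at this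
        exact this.symm
      have hgw : g w' = ∑ i : {i // i ≠ i₀}, w' i • ((i : t) : E) := by
        have := Fintype.sum_eq_add_sum_subtype_ne (fun i : t ↦ w' i • (i : E)) i₀
        rwa [h0, zero_smul, zero_add] at this
      have : Nonempty {i // i ≠ i₀} := by
        by_contra hemp
        rw [not_nonempty_iff] at hemp
        simp at hsum
      rw [hgw]
      refine h.infDist_sum_le (fun i ↦ htA i.1.2) ?_ (fun i ↦ hw'.1 i) hsum
      rw [Fintype.card_subtype_compl, Fintype.card_subtype_eq, Fintype.card_coe]
      omega

end Euclidean

theorem theorem1p1 (n : ℕ) (hn : 1 ≤ n) :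
    (∀ (E : Type*) [NormedAddCommGroup E] [NormedSpace ℝ E], Module.finrank ℝ E = n →
      ∃ C : ℝ, IsSharpHullConstant E C ∧ kappa (n - 1) ≤ C ∧ C ≤ kappa n) ∧
    (2 ≤ n → IsSharpHullConstant (EuclideanSpace ℝ (Fin n)) (kappa (n - 1))) := by
  constructor
  · intro E _ _ hE
    have : FiniteDimensional ℝ E := FiniteDimensional.of_finrank_pos (by omega)
    refine exists_isSharpHullConstant ?_ fun c hc ↦ kappa_le_of_isHullConstant (by omega) hc
    rw [← hE]
    exact isHullConstant_kappa_finrank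
  · intro hn2
    have hE : Module.finrank ℝ (EuclideanSpace ℝ (Fin n)) = n := by simp
    refine ⟨?_, fun c hc ↦ kappa_le_of_isHullConstant (by omega) hc⟩
    have := isHullConstant_kappa_finrank_sub_one (E := EuclideanSpace ℝ (Fin n)) (by omega)
    rwa [hE] at this
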